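/- For a Hamilton cycle $H$ of a graph on the vertex set $[n]=\{1,\dots,n\}$, written as the sequence $(i_1=1,i_2,\dots,i_n)$ of its vertices in the order in which they are visited when $H$ is traversed from vertex $1$ in one of its two directions, let $\iota(H)=|\{(k,\ell): k<\ell,\ i_k>i_\ell\}|$ be the number of inversions of this sequence. **Theorem 7.** Let $K>0$ be a constant, and let $M=M(n)>0$ and $p=p(n)\in[0,1]$ satisfy, for all sufficiently large $n$, $$M\le \frac{Kn^2}{\log^2 n}\qquad\text{and}\qquad p\ge \frac{100\max\{K,1\}\,n}{M}.$$ Then, with probability tending to $1$ as $n\to\infty$, the binomial random graph $G_{n,p}$ on $[n]$ contains a Hamilton cycle $H$, with a suitable choice of direction, such that $\iota(H)\le M$. -/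

import Mathlib

/-- A closed walk `c` from `a` in a graph on the ordered vertex set `Fin n` is read as the vertex
sequence `(c.getVert 0, c.getVert 1, …, c.getVert (n - 1))`, which begins at `a`; for a Hamilton
cycle this lists every vertex exactly once. `cycleInversions c` is the number of pairs of
positions `k < l` at which the earlier vertex is the larger one. -/
def cycleInversions {n : ℕ} {G : SimpleGraph (Fin n)} {a : Fin n} (c : G.Walk a a) : ℕ :=
  (Finset.univ.filter fun q : Fin n × Fin n =>
    q.1 < q.2 ∧ c.getVert (q.2 : ℕ) < c.getVert (q.1 : ℕ)).card

/-- `G` contains a Hamilton cycle which, traversed from the smallest vertex (in one of its two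
directions, the one in which the walk runs), has at most `M` inversions. -/
def HasHamiltonCycleWithInversionsLE {n : ℕ} (G : SimpleGraph (Fin n)) (M : ℝ) : Prop :=
  ∃ (a : Fin n) (c : G.Walk a a),
    (a : ℕ) = 0 ∧ c.IsHamiltonianCycle ∧ (cycleInversions c : ℝ) ≤ M

/-! The hypotheses on `M` and `p` give `n p ≥ 100 log² n` and `100 n / p ≤ M`, so it suffices to
find a Hamilton cycle with at most `100 n / p` inversions.

Build the cycle greedily: from the current vertex `s` move to its smallest neighbour `u` among the
unused vertices `U`. The vertices of `U` below `u` are the only later ones inverted with `u`, and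
all of them are non-neighbours of `s`, so the cost of a step is dominated by a geometric variable of
parameter `p`. Only edges at `s` are inspected and `s` never returns, so successive steps use fresh
randomness. An exponential moment bounds the total cost by `O(n / p)`
(`binomialRandom_not_hasOrderedPath_le`).

The greedy walk is stopped when `N = 5 k` vertices remain, with `k` of order `log n / p`. These are
covered by any path from `s` ending at a neighbour of the root `z`; its inversions are at most `N²`,
of order `log² n / p²`, which is `O(n / p)` since `n p ≥ 100 log² n`. Such a path comes from Pósa
rotations: in an expanding graph the longest paths ending at `s` have many starting points
(`ExpandsIn.card_lt`). The paths avoiding `x` do not depend on the edges at `x`, so `x` is very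
likely joined to one of these starts; if this holds for all `x`, a longest path misses nothing
(`exists_hamiltonian_isPathInto`).

The edges at `z` are needed at the end of the path, so the first neighbour of `z` is not exposed:
the path is found from every possible second vertex, at the cost of a factor `n` in the union bound.
-/

/-! ### Independence of disjoint sets of pairs in the binomial random graph. -/

section EdgeProbability

open SimpleGraph

variable {V : Type*}

/-- The graph property `E` does not depend on which of the pairs in `D` are edges. -/
def IgnoresEdges (D : Set (Sym2 V)) (E : SimpleGraph V → Prop) : Prop :=
  ∀ G G' : SimpleGraph V, (∀ e, e ∉ D → (e ∈ G.edgeSet ↔ e ∈ G'.edgeSet)) → (E G ↔ E G')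

theorem IgnoresEdges.mono {D D' : Set (Sym2 V)} {E : SimpleGraph V → Prop}
    (h : IgnoresEdges D E) (hD : D' ⊆ D) : IgnoresEdges D' E :=
  fun G G' hG => h G G' fun e he => hG e fun he' => he (hD he')

theorem IgnoresEdges.and {D : Set (Sym2 V)} {E F : SimpleGraph V → Prop}
    (hE : IgnoresEdges D E) (hF : IgnoresEdges D F) : IgnoresEdges D fun G => E G ∧ F G :=
  fun G G' hG => and_congr (hE G G' hG) (hF G G' hG)

theorem ignoresEdges_forall_notMem {D A : Set (Sym2 V)} (h : Disjoint A D) :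
    IgnoresEdges D fun G : SimpleGraph V => ∀ e ∈ A, e ∉ G.edgeSet :=
  fun _ _ hG => forall₂_congr fun e he => not_congr (hG e (Set.disjoint_left.1 h he))

variable [Fintype V] (p : unitInterval)

theorem measurableSet_simpleGraph (S : Set (SimpleGraph V)) : MeasurableSet S := by
  rw [← measurableEmbedding_edgeSet.measurableSet_image]
  exact (Set.toFinite _).measurableSet

theorem binomialRandom_real_eq_sum [DecidableEq V] (E : SimpleGraph V → Prop) [DecidablePred E] :
    (binomialRandom V p).real {G | E G} =
      ∑ G : SimpleGraph V with E G, (p : ℝ) ^ G.edgeSet.ncard *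
        (1 - p : ℝ) ^ ((Nat.card V).choose 2 - G.edgeSet.ncard) := by
  have _ : MeasurableSingletonClass (SimpleGraph V) := ⟨fun _ => measurableSet_simpleGraph _⟩
  have : {G : SimpleGraph V | E G} = ↑(Finset.univ.filter E) := by ext; simp
  rw [this, ← MeasureTheory.sum_measureReal_singleton]
  refine Finset.sum_congr rfl fun G _ => ?_
  simp [MeasureTheory.measureReal_def]

theorem ncard_edgeSet_le (G : SimpleGraph V) : G.edgeSet.ncard ≤ (Nat.card V).choose 2 := by
  classical
  have := G.card_edgeFinset_le_card_choose_two
  rwa [Nat.card_eq_fintype_card, ← coe_edgeFinset, Set.ncard_coe_finset]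

/-- Toggling `e` is a bijection between the two events that changes the weight by the factor `p / (1
- p)`; the cross-multiplied form also covers `p = 0` and `p = 1`. -/
theorem one_sub_mul_binomialRandom_mem (e : Sym2 V) (he : ¬ e.IsDiag)
    {E : SimpleGraph V → Prop} (hE : IgnoresEdges {e} E) :
    (1 - p : ℝ) * (binomialRandom V p).real {G | E G ∧ e ∈ G.edgeSet} =
      p * (binomialRandom V p).real {G | E G ∧ e ∉ G.edgeSet} := by
  classical
  rw [binomialRandom_real_eq_sum, binomialRandom_real_eq_sum, Finset.mul_sum, Finset.mul_sum]
  have hdel : ∀ G : SimpleGraph V, (G.deleteEdges {e}).edgeSet = G.edgeSet \ {e} := by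
    intro G; simp
  have hadd : ∀ G : SimpleGraph V, (G ⊔ fromEdgeSet {e}).edgeSet = insert e G.edgeSet := by
    intro G
    simp only [edgeSet_sup, edgeSet_fromEdgeSet]
    ext f
    simp only [Set.mem_union, Set.mem_sdiff, Set.mem_singleton_iff, Set.mem_insert_iff, Sym2.mem_diagSet]
    constructor
    · tauto
    · rintro (rfl | h) <;> tauto
  refine Finset.sum_nbij' (fun G => G.deleteEdges {e}) (fun G => G ⊔ fromEdgeSet {e})
    ?_ ?_ ?_ ?_ ?_
  · intro G hG
    simp only [Finset.mem_filter, Finset.mem_univ, true_and] at hG ⊢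
    refine ⟨(hE G _ fun f hf => ?_).1 hG.1, ?_⟩
    · rw [hdel]; simp_all
    · rw [hdel]; simp
  · intro G hG
    simp only [Finset.mem_filter, Finset.mem_univ, true_and] at hG ⊢
    refine ⟨(hE G _ fun f hf => ?_).1 hG.1, ?_⟩
    · rw [hadd]; simp_all
    · rw [hadd]; simp
  · intro G hG
    simp only [Finset.mem_filter, Finset.mem_univ, true_and] at hG
    rw [← edgeSet_inj, hadd, hdel]
    simp [hG.2]
  · intro G hG
    simp only [Finset.mem_filter, Finset.mem_univ, true_and] at hG
    rw [← edgeSet_inj, hdel, hadd]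
    simp [hG.2]
  · intro G hG
    simp only [Finset.mem_filter, Finset.mem_univ, true_and] at hG
    have h1 : (G.deleteEdges {e}).edgeSet.ncard + 1 = G.edgeSet.ncard := by
      rw [hdel]; exact Set.ncard_sdiff_singleton_add_one hG.2
    have h2 := ncard_edgeSet_le G
    have h3 : (Nat.card V).choose 2 - (G.deleteEdges {e}).edgeSet.ncard =
      (Nat.card V).choose 2 - G.edgeSet.ncard + 1 := by omega
    rw [h3, ← h1]
    ring

theorem binomialRandom_and_mem (e : Sym2 V) (he : ¬ e.IsDiag)
    {E : SimpleGraph V → Prop} (hE : IgnoresEdges {e} E) :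
    (binomialRandom V p).real {G | E G ∧ e ∈ G.edgeSet} = p * (binomialRandom V p).real {G | E G} ∧
    (binomialRandom V p).real {G | E G ∧ e ∉ G.edgeSet} =
      (1 - p) * (binomialRandom V p).real {G | E G} := by
  have h1 := one_sub_mul_binomialRandom_mem p e he hE
  have h2 : (binomialRandom V p).real {G | E G ∧ e ∈ G.edgeSet} +
      (binomialRandom V p).real {G | E G ∧ e ∉ G.edgeSet} =
      (binomialRandom V p).real {G | E G} :=
    MeasureTheory.measureReal_inter_add_sdiff (s := {G | E G}) (t := {G | e ∈ G.edgeSet})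
      (measurableSet_simpleGraph _)
  constructor
  · linear_combination p * h2 + h1
  · linear_combination (1 - p) * h2 - h1

theorem binomialRandom_and_forall_notMem (D : Finset (Sym2 V)) (hD : ∀ e ∈ D, ¬ e.IsDiag)
    {E : SimpleGraph V → Prop} (hE : IgnoresEdges (D : Set (Sym2 V)) E) :
    (binomialRandom V p).real {G | E G ∧ ∀ e ∈ D, e ∉ G.edgeSet} =
      (1 - p : ℝ) ^ D.card * (binomialRandom V p).real {G | E G} := by
  classical
  induction D using Finset.induction_on with
  | empty => simp
  | insert e D heD ih =>
    have hrw : {G : SimpleGraph V | E G ∧ ∀ f ∈ insert e D, f ∉ G.edgeSet} =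
        {G | (E G ∧ ∀ f ∈ D, f ∉ G.edgeSet) ∧ e ∉ G.edgeSet} := by
      ext G
      simp only [Finset.forall_mem_insert, Set.mem_ofPred_eq]
      tauto
    rw [hrw, (binomialRandom_and_mem p e (hD e (by simp)) _).2,
      ih (fun f hf => hD f (by simp [hf])) (hE.mono (by simp)), Finset.card_insert_of_notMem heD]
    · ring
    · refine (hE.mono (by simp)).and (ignoresEdges_forall_notMem (A := (D : Set (Sym2 V))) ?_)
      simpa using heD

/-- `E` is determined by the subgraph induced on `X`. -/
def DependsOnInduced (X : Set V) (E : SimpleGraph V → Prop) : Prop :=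
  ∀ G G' : SimpleGraph V, (∀ a ∈ X, ∀ b ∈ X, (G.Adj a b ↔ G'.Adj a b)) → (E G ↔ E G')

omit [Fintype V] in
theorem DependsOnInduced.ignoresEdges {X : Set V} {E : SimpleGraph V → Prop}
    (h : DependsOnInduced X E) {D : Set (Sym2 V)} (hD : ∀ e ∈ D, ∃ v ∈ e, v ∉ X) :
    IgnoresEdges D E := by
  intro G G' hG
  refine h G G' fun a ha b hb => hG s(a, b) fun hab => ?_
  obtain ⟨v, hv, hvX⟩ := hD _ hab
  rcases Sym2.mem_iff.1 hv with rfl | rfl <;> exact hvX ‹_›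

/-- Every pair `s(x, b)` leaves `X`, so the star at `x` is independent of `E`, even when `B` lies in
`X`. -/
theorem binomialRandom_and_forall_not_adj [DecidableEq V] {x : V} {B : Finset V} (hx : x ∉ B)
    {X : Set V} (hxX : x ∉ X) {E : SimpleGraph V → Prop} (hE : DependsOnInduced X E) :
    (binomialRandom V p).real {G | E G ∧ ∀ b ∈ B, ¬ G.Adj x b} =
      (1 - p : ℝ) ^ B.card * (binomialRandom V p).real {G | E G} := by
  rw [← Finset.card_image_of_injOn (s := B) (f := fun b => s(x, b)) (by
    intro a _ b _ hab; exact Sym2.congr_right.1 hab)]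
  rw [← binomialRandom_and_forall_notMem]
  · simp
  · simp only [Finset.mem_image, forall_exists_index, and_imp]
    rintro _ b hb rfl h
    exact hx ((Sym2.mk_isDiag_iff.1 h) ▸ hb)
  · refine hE.ignoresEdges ?_
    simp only [Finset.coe_image, Set.mem_image, Finset.mem_coe, forall_exists_index, and_imp]
    rintro _ b hb rfl
    exact ⟨x, by simp, hxX⟩

theorem binomialRandom_and_adj_and_forall_not_adj [DecidableEq V] {x u : V} {B : Finset V}
    (hx : x ∉ B) (hxu : x ≠ u) (hu : u ∉ B)
    {X : Set V} (hxX : x ∉ X) {E : SimpleGraph V → Prop} (hE : DependsOnInduced X E) :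
    (binomialRandom V p).real {G | (E G ∧ ∀ b ∈ B, ¬ G.Adj x b) ∧ G.Adj x u} =
      p * ((1 - p : ℝ) ^ B.card * (binomialRandom V p).real {G | E G}) := by
  rw [← binomialRandom_and_forall_not_adj p hx hxX hE]
  refine (binomialRandom_and_mem p s(x, u) (by simpa using hxu) (IgnoresEdges.and ?_ ?_)).1
  · refine hE.ignoresEdges ?_
    rintro _ rfl
    exact ⟨x, by simp, hxX⟩
  · intro G G' hG
    refine forall₂_congr fun b hb => not_congr (hG s(x, b) ?_)
    rintro h
    have : b = u := Sym2.congr_right.1 h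
    exact hu (this ▸ hb)

theorem binomialRandom_no_edge_between [DecidableEq V] {S R : Finset V} (h : Disjoint S R) :
    (binomialRandom V p).real {G | ∀ a ∈ S, ∀ b ∈ R, ¬ G.Adj a b} =
      ((1 - p : ℝ) ^ R.card) ^ S.card := by
  induction S using Finset.induction_on with
  | empty => simp
  | insert x S hxS ih =>
    have hrw : {G : SimpleGraph V | ∀ a ∈ insert x S, ∀ b ∈ R, ¬ G.Adj a b} =
        {G | (∀ a ∈ S, ∀ b ∈ R, ¬ G.Adj a b) ∧ ∀ b ∈ R, ¬ G.Adj x b} := by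
      ext G
      simp only [Finset.forall_mem_insert, Set.mem_ofPred_eq]
      tauto
    simp only [Finset.disjoint_insert_left] at h
    rw [hrw, binomialRandom_and_forall_not_adj p h.1 (X := ↑(S ∪ R)), ih h.2,
      Finset.card_insert_of_notMem hxS, pow_succ, mul_comm]
    · simp [hxS, h.1]
    · intro G G' hG
      refine forall₂_congr fun a ha => forall₂_congr fun b hb => not_congr (hG a ?_ b ?_) <;>
        simp [ha, hb]

end EdgeProbability

/-! ### Pósa rotations and longest paths with one fixed end. -/

section Posa

open SimpleGraph

variable {V : Type*}

/-- `l` lists the vertices of a path inside `X` whose last vertex is `s`. -/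
def IsPathInto (G : SimpleGraph V) (X : Finset V) (s : V) (l : List V) : Prop :=
  l.IsChain G.Adj ∧ l.Nodup ∧ (∀ v ∈ l, v ∈ X) ∧ l.getLast? = some s

/-- `l` is a longest path inside `X` among those ending at `s`. -/
def IsLongestPathInto (G : SimpleGraph V) (X : Finset V) (s : V) (l : List V) : Prop :=
  IsPathInto G X s l ∧ ∀ l', IsPathInto G X s l' → l'.length ≤ l.length

open Classical in
/-- The starting points of the longest paths inside `X` ending at `s`. -/
noncomputable def longestPathStarts (G : SimpleGraph V) (X : Finset V) (s : V) : Finset V :=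
  X.filter fun v => ∃ t, IsLongestPathInto G X s (v :: t)

/-- The lists obtained from `P` by Pósa rotations that keep the last vertex fixed. -/
inductive Rotates (G : SimpleGraph V) (P : List V) : List V → Prop
  | refl : Rotates G P P
  | rotate {v w : V} {A B : List V} (h : Rotates G P (v :: A ++ w :: B)) (hvw : G.Adj v w) :
      Rotates G P ((v :: A).reverse ++ w :: B)

variable {G : SimpleGraph V} {X : Finset V} {s : V} {P l : List V}

theorem mem_longestPathStarts {v : V} :
    v ∈ longestPathStarts G X s ↔ v ∈ X ∧ ∃ t, IsLongestPathInto G X s (v :: t) := by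
  simp [longestPathStarts]

theorem Rotates.isPathInto (h : Rotates G P l) (hP : IsPathInto G X s P) :
    IsPathInto G X s l ∧ l.length = P.length := by
  induction h with
  | refl => exact ⟨hP, rfl⟩
  | @rotate v w A B h hvw ih =>
    obtain ⟨⟨h1, h2, h3, h4⟩, h5⟩ := ih
    have hperm : ((v :: A).reverse ++ w :: B).Perm (v :: A ++ w :: B) :=
      (List.reverse_perm _).append_right _
    refine ⟨⟨?_, hperm.nodup_iff.2 h2, fun x hx => h3 x (hperm.mem_iff.1 hx), ?_⟩,
      hperm.length_eq.trans h5⟩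
    · rw [List.isChain_append] at h1 ⊢
      refine ⟨?_, h1.2.1, ?_⟩
      · rw [List.isChain_reverse]
        exact h1.1.imp fun _ _ h => h.symm
      · simp [hvw]
    · rwa [List.getLast?_append_of_ne_nil _ (by simp)] at h4 ⊢

theorem Rotates.isLongestPathInto (h : Rotates G P l) (hP : IsLongestPathInto G X s P) :
    IsLongestPathInto G X s l := by
  obtain ⟨h1, h2⟩ := h.isPathInto hP.1
  exact ⟨h1, h2 ▸ hP.2⟩

/-- Rotating along the edge `v w` makes the predecessor `x` of `w` the new starting point. -/
theorem Rotates.exists_last {v w : V} {A B : List V} (h : Rotates G P (v :: A ++ w :: B))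
    (hvw : G.Adj v w) : ∃ x C, v :: A = C ++ [x] ∧ ∃ t, Rotates G P (x :: t) := by
  obtain ⟨C, x, hx⟩ := List.eq_nil_or_concat' (v :: A) |>.resolve_left (by simp)
  refine ⟨x, C, hx, C.reverse ++ w :: B, ?_⟩
  have := h.rotate hvw
  rw [hx] at this
  simpa using this

/-- The neighbours of `y` along the list avoid `S`. -/
def AvoidsNext (y : V) (S : Set V) (a b : V) : Prop :=
  (a = y → b ∉ S) ∧ (b = y → a ∉ S)

/-- A rotation creates one new consecutive pair, `v` and `w`. Here `v` is an endpoint, hence not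
`y`; and if `w = y`, then its former predecessor, also an endpoint, was already next to `y`. -/
theorem Rotates.isChain_avoidsNext (h : Rotates G P l) {y : V}
    (hy : y ∉ {v | ∃ t, Rotates G P (v :: t)})
    (hP : P.IsChain (AvoidsNext y {v | ∃ t, Rotates G P (v :: t)})) :
    l.IsChain (AvoidsNext y {v | ∃ t, Rotates G P (v :: t)}) := by
  induction h with
  | refl => exact hP
  | @rotate v w A B h hvw ih =>
    obtain ⟨x, C, hx, hxS⟩ := h.exists_last hvw
    rw [List.isChain_append] at ih ⊢
    have hxw := ih.2.2 x (by rw [hx]; simp) w (by simp)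
    refine ⟨?_, ih.2.1, ?_⟩
    · rw [List.isChain_reverse]
      exact ih.1.imp fun _ _ h => ⟨h.2, h.1⟩
    · simp only [List.getLast?_reverse, List.head?_cons, Option.mem_def, Option.some.injEq,
        forall_eq']
      refine ⟨?_, ?_⟩
      · rintro rfl
        exact absurd ⟨_, h⟩ hy
      · rintro rfl
        exact absurd hxS (hxw.2 rfl)

/-- Every vertex outside the set of endpoints adjacent to it is next to it along `P`. -/
theorem not_isChain_avoidsNext (hP : IsLongestPathInto G X s P) {y v : V} (hyX : y ∈ X)
    (hv : v ∈ {v | ∃ t, Rotates G P (v :: t)}) (hy : y ∉ {v | ∃ t, Rotates G P (v :: t)})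
    (hvy : G.Adj v y) : ¬ P.IsChain (AvoidsNext y {v | ∃ t, Rotates G P (v :: t)}) := by
  intro hc
  obtain ⟨t, ht⟩ := hv
  have hl := ht.isLongestPathInto hP
  have hyl : y ∈ v :: t := by
    by_contra hyl
    have : IsPathInto G X s (y :: v :: t) := by
      refine ⟨List.isChain_cons_cons.2 ⟨hvy.symm, hl.1.1⟩, List.nodup_cons.2 ⟨hyl, hl.1.2.1⟩, ?_, ?_⟩
      · intro x hx
        rcases List.mem_cons.1 hx with rfl | hx
        exacts [hyX, hl.1.2.2.1 _ hx]
      · rw [List.getLast?_cons_cons]; exact hl.1.2.2.2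
    have := hl.2 _ this
    simp at this
  have hyt : y ∈ t := by
    rcases List.mem_cons.1 hyl with rfl | h
    · exact absurd hvy (G.loopless.irrefl _)
    · exact h
  -- Rotating along `v y` turns the predecessor of `y` into an endpoint, contradicting that no
  -- endpoint is next to `y`.
  obtain ⟨A, B, rfl⟩ := List.append_of_mem hyt
  have hch := ht.isChain_avoidsNext hy hc
  obtain ⟨x, C, hx, hxS⟩ := Rotates.exists_last (A := A) (B := B) ht hvy
  rw [← List.cons_append, List.isChain_append] at hch
  have hxw := hch.2.2 x (by rw [hx]; simp) y (by simp)
  exact hxw.2 rfl hxS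

/-- Each vertex of `S` has at most one successor and one predecessor on `P`; at index `0` the
truncated subtraction merely adds the vertex itself. -/
theorem card_image_next_le [DecidableEq V] (hP : P.Nodup) (S : Finset V) :
    ∃ T : Finset V, T.card ≤ 2 * S.card ∧
      ∀ y, ¬ P.IsChain (AvoidsNext y (S : Set V)) → y ∈ T := by
  refine ⟨S.biUnion fun v => (P[P.idxOf v + 1]?).toFinset ∪ (P[P.idxOf v - 1]?).toFinset, ?_, ?_⟩
  · rw [mul_comm]
    refine Finset.card_biUnion_le_card_mul _ _ _ fun v _ => (Finset.card_union_le _ _).trans ?_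
    have : ∀ o : Option V, o.toFinset.card ≤ 1 := by rintro (_ | _) <;> simp
    have h1 := this P[P.idxOf v + 1]?
    have h2 := this P[P.idxOf v - 1]?
    omega
  · intro y hy
    simp only [List.isChain_iff_getElem, not_forall] at hy
    obtain ⟨i, hi, h⟩ := hy
    simp only [AvoidsNext, Classical.not_and_iff_not_or_not, Classical.not_imp, not_not,
      Finset.mem_coe] at h
    simp only [Finset.mem_biUnion, Finset.mem_union, Option.mem_toFinset, Option.mem_def]
    rcases h with ⟨h1, h2⟩ | ⟨h1, h2⟩
    · refine ⟨_, h2, Or.inr ?_⟩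
      rw [hP.idxOf_getElem]
      simp [← h1]
    · refine ⟨_, h2, Or.inl ?_⟩
      rw [hP.idxOf_getElem]
      simp [← h1]

theorem isPathInto_singleton (hs : s ∈ X) : IsPathInto G X s [s] := by
  simp [IsPathInto, hs]

theorem IsPathInto.length_le (h : IsPathInto G X s l) : l.length ≤ X.card := by
  classical
  rw [← List.toFinset_card_of_nodup h.2.1]
  exact Finset.card_le_card fun v hv => h.2.2.1 v (List.mem_toFinset.1 hv)

theorem exists_isLongestPathInto (G : SimpleGraph V) (hs : s ∈ X) :
    ∃ v t, IsLongestPathInto G X s (v :: t) := by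
  classical
  have hne : ∃ n, ∃ l, IsPathInto G X s l ∧ X.card - l.length = n := ⟨_, [s], isPathInto_singleton hs, rfl⟩
  obtain ⟨l, hl, hn⟩ := Nat.find_spec hne
  have hlong : IsLongestPathInto G X s l := by
    refine ⟨hl, fun l' hl' => ?_⟩
    have h1 := Nat.find_min' hne ⟨l', hl', rfl⟩
    have h2 := hl.length_le
    have h3 := hl'.length_le
    omega
  cases l with
  | nil => simp [IsPathInto] at hl
  | cons v t => exact ⟨v, t, hlong⟩

/-- Every nonempty `S ⊆ X` with at most a fifth of the vertices of `X` has more than `2 |S|`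
neighbours in `X` outside `S`. -/
def ExpandsIn [DecidableEq V] (G : SimpleGraph V) (X : Finset V) : Prop :=
  ∀ S T : Finset V, S ⊆ X → S.Nonempty → 5 * S.card ≤ X.card → T ⊆ X → T.card = 2 * S.card →
    ∃ a ∈ S, ∃ b ∈ X \ (S ∪ T), G.Adj a b

/-- Pósa's lemma: the neighbours in `X` of the rotation endpoints `S` outside `S` are next to `S` on
the initial path, so there are at most `2 |S|` of them; expansion forbids this when `S` is small. -/
theorem ExpandsIn.card_lt [DecidableEq V] (h : ExpandsIn G X) (hs : s ∈ X) :
    X.card < 5 * (longestPathStarts G X s).card := by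
  classical
  obtain ⟨v, t, hP⟩ := exists_isLongestPathInto G hs
  set S : Finset V := X.filter fun x => ∃ t', Rotates G (v :: t) (x :: t') with hS
  have hScoe : (S : Set V) = {x | ∃ t', Rotates G (v :: t) (x :: t')} := by
    ext x
    simp only [hS, Finset.coe_filter, Set.mem_ofPred_eq, and_iff_right_iff_imp]
    rintro ⟨t', ht'⟩
    exact (ht'.isPathInto hP.1).1.2.2.1 x (by simp)
  have hsub : S ⊆ longestPathStarts G X s := by
    intro x hx
    simp only [hS, Finset.mem_filter, mem_longestPathStarts] at hx ⊢
    exact ⟨hx.1, hx.2.imp fun t' ht' => ht'.isLongestPathInto hP⟩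
  refine lt_of_lt_of_le ?_ (Nat.mul_le_mul_left 5 (Finset.card_le_card hsub))
  by_contra! hcard
  obtain ⟨T, hT, hT'⟩ := card_image_next_le hP.1.2.1 S
  -- `ExpandsIn` asks for a set of size exactly `2 |S|`, so `T ∩ X` is padded inside `X`.
  have hTX : (T ∩ X).card ≤ 2 * S.card := (Finset.card_le_card Finset.inter_subset_left).trans hT
  obtain ⟨T', hTT', hT'X, hT'c⟩ := Finset.exists_subsuperset_card_eq
    (Finset.inter_subset_right (s₁ := T) (s₂ := X)) hTX (by omega)
  obtain ⟨a, ha, b, hb, hab⟩ := h S T' (Finset.filter_subset _ _)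
    ⟨v, by simpa [hS] using ⟨hP.1.2.2.1 v (by simp), t, Rotates.refl⟩⟩ hcard hT'X hT'c
  simp only [Finset.mem_sdiff, Finset.mem_union, not_or] at hb
  refine hb.2.2 (hTT' (Finset.mem_inter.2 ⟨hT' b ?_, hb.1⟩))
  rw [hScoe]
  refine not_isChain_avoidsNext hP hb.1 (v := a) ?_ ?_ hab
  · rw [← hScoe]; exact ha
  · rw [← hScoe]; exact hb.2.1

theorem isPathInto_congr {G' : SimpleGraph V}
    (h : ∀ a ∈ X, ∀ b ∈ X, (G.Adj a b ↔ G'.Adj a b)) :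
    IsPathInto G X s l ↔ IsPathInto G' X s l := by
  have key : ∀ {H H' : SimpleGraph V}, (∀ a ∈ X, ∀ b ∈ X, (H.Adj a b ↔ H'.Adj a b)) →
      IsPathInto H X s l → IsPathInto H' X s l := fun hH hl =>
    ⟨hl.1.imp_of_mem_imp fun a b ha hb hab => (hH a (hl.2.2.1 a ha) b (hl.2.2.1 b hb)).1 hab, hl.2⟩
  exact ⟨key h, key fun a ha b hb => (h a ha b hb).symm⟩

theorem longestPathStarts_congr {G' : SimpleGraph V}
    (h : ∀ a ∈ X, ∀ b ∈ X, (G.Adj a b ↔ G'.Adj a b)) :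
    longestPathStarts G X s = longestPathStarts G' X s := by
  ext v
  simp only [mem_longestPathStarts, IsLongestPathInto, isPathInto_congr h]

/-- If for every `x ∈ W` other than `s` the longest paths avoiding `x` can be extended to `x`, then
there is a path through all of `W`, starting at a neighbour of `z`. -/
theorem exists_hamiltonian_isPathInto [DecidableEq V] {W : Finset V} {z : V} (hs : s ∈ W)
    (h : ∀ x ∈ W.erase s, ∃ a ∈ longestPathStarts G (W.erase x) s, G.Adj x a)
    (hz : ∃ a ∈ longestPathStarts G W s, G.Adj z a) :
    ∃ v t, IsPathInto G W s (v :: t) ∧ (v :: t).toFinset = W ∧ G.Adj z v := by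
  obtain ⟨v, hv, hzv⟩ := hz
  simp only [mem_longestPathStarts] at hv
  obtain ⟨hvW, t, ht⟩ := hv
  refine ⟨v, t, ht.1, ?_, hzv⟩
  refine Finset.Subset.antisymm (fun x hx => ht.1.2.2.1 x (List.mem_toFinset.1 hx)) ?_
  intro x hxW
  by_contra hx
  rw [List.mem_toFinset] at hx
  have hsl : s ∈ v :: t := List.mem_of_getLast? ht.1.2.2.2
  have hxs : x ≠ s := by rintro rfl; exact hx hsl
  obtain ⟨a, ha, hxa⟩ := h x (Finset.mem_erase.2 ⟨hxs, hxW⟩)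
  simp only [mem_longestPathStarts] at ha
  obtain ⟨-, t', ht'⟩ := ha
  -- A longest path missing `x` already lives in `W.erase x`, so the longest path there is no
  -- shorter, and prepending `x` to it beats the maximum in `W`.
  have h1 : (v :: t).length ≤ (a :: t').length := by
    refine ht'.2 _ ⟨ht.1.1, ht.1.2.1, fun y hy => Finset.mem_erase.2 ⟨?_, ht.1.2.2.1 y hy⟩, ht.1.2.2.2⟩
    rintro rfl; exact hx hy
  have h2 : (x :: a :: t').length ≤ (v :: t).length := by
    refine ht.2 _ ⟨List.isChain_cons_cons.2 ⟨hxa, ht'.1.1⟩, List.nodup_cons.2 ⟨fun hxl => ?_, ht'.1.2.1⟩,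
      fun y hy => ?_, ?_⟩
    · exact absurd (ht'.1.2.2.1 x hxl) (Finset.notMem_erase x W)
    · rcases List.mem_cons.1 hy with rfl | hy
      exacts [hxW, Finset.mem_of_mem_erase (ht'.1.2.2.1 y hy)]
    · rw [List.getLast?_cons_cons]; exact ht'.1.2.2.2
  simp at h1 h2
  omega

end Posa

/-! ### Probability that a random graph expands and has a spanning path. -/

section Expansion

open SimpleGraph

variable {V : Type*} [Fintype V] [DecidableEq V] (p : unitInterval)

omit [Fintype V] [DecidableEq V] in
theorem binomialRandom_exists_le {ι : Type*} (I : Finset ι) (Q : ι → SimpleGraph V → Prop) :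
    (binomialRandom V p).real {G | ∃ i ∈ I, Q i G} ≤
      ∑ i ∈ I, (binomialRandom V p).real {G | Q i G} := by
  refine le_trans (le_of_eq ?_) (MeasureTheory.measureReal_biUnion_finset_le I fun i => {G | Q i G})
  congr 1
  ext G
  simp

omit [DecidableEq V] in
theorem binomialRandom_mono {E F : SimpleGraph V → Prop} (h : ∀ G, E G → F G) :
    (binomialRandom V p).real {G | E G} ≤ (binomialRandom V p).real {G | F G} :=
  MeasureTheory.measureReal_mono fun G hG => h G hG

omit [Fintype V] [DecidableEq V] in
theorem binomialRandom_or_le (E F : SimpleGraph V → Prop) :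
    (binomialRandom V p).real {G | E G ∨ F G} ≤
      (binomialRandom V p).real {G | E G} + (binomialRandom V p).real {G | F G} :=
  MeasureTheory.measureReal_union_le _ _

/-- Union bound over `S` and `T`: as `|S ∪ T| ≤ 3 |S| ≤ 3 |X| / 5`, at least `r` vertices remain,
each pair fails with probability at most `(1 - p) ^ (r |S|)`, and there are at most `|X| ^ (3 |S|)`
pairs. -/
theorem binomialRandom_not_expandsIn_le {X : Finset V} {r : ℕ} (hr : 5 * r ≤ 2 * X.card) {δ : ℝ}
    (hδ : (X.card : ℝ) ^ 3 * (1 - p : ℝ) ^ r ≤ δ) (hδ1 : δ ≤ 1) :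
    (binomialRandom V p).real {G | ¬ ExpandsIn G X} ≤ X.card * δ := by
  have hp0 : (0 : ℝ) ≤ 1 - p := sub_nonneg.2 p.2.2
  have hp1 : (1 - p : ℝ) ≤ 1 := sub_le_self _ p.2.1
  set I : Finset ℕ := (Finset.Icc 1 X.card).filter fun k => 5 * k ≤ X.card
  have hδ0 : 0 ≤ δ := le_trans (by positivity) hδ
  have key : (binomialRandom V p).real {G | ¬ ExpandsIn G X} ≤
      (binomialRandom V p).real {G | ∃ k ∈ I, ∃ S ∈ X.powersetCard k, ∃ T ∈ X.powersetCard (2 * k),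
        ∀ a ∈ S, ∀ b ∈ X \ (S ∪ T), ¬ G.Adj a b} := by
    refine binomialRandom_mono p fun G hG => ?_
    simp only [ExpandsIn, not_forall, not_exists, not_and] at hG
    obtain ⟨S, T, hS, hSn, hSc, hT, hTc, h⟩ := hG
    refine ⟨S.card, ?_, S, Finset.mem_powersetCard.2 ⟨hS, rfl⟩, T,
      Finset.mem_powersetCard.2 ⟨hT, hTc⟩, h⟩
    simp only [I, Finset.mem_filter, Finset.mem_Icc]
    exact ⟨⟨hSn.card_pos, Finset.card_le_card hS⟩, hSc⟩
  refine key.trans ((binomialRandom_exists_le p _ _).trans ?_)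
  have hterm : ∀ k ∈ I, (binomialRandom V p).real {G | ∃ S ∈ X.powersetCard k,
      ∃ T ∈ X.powersetCard (2 * k), ∀ a ∈ S, ∀ b ∈ X \ (S ∪ T), ¬ G.Adj a b} ≤ δ := by
    intro k hk
    simp only [I, Finset.mem_filter, Finset.mem_Icc] at hk
    have hST : ∀ S ∈ X.powersetCard k, ∀ T ∈ X.powersetCard (2 * k),
        (binomialRandom V p).real {G | ∀ a ∈ S, ∀ b ∈ X \ (S ∪ T), ¬ G.Adj a b} ≤
          ((1 - p : ℝ) ^ r) ^ k := by
      intro S hS T hT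
      rw [Finset.mem_powersetCard] at hS hT
      rw [binomialRandom_no_edge_between, hS.2]
      · refine pow_le_pow_left₀ (by positivity) (pow_le_pow_of_le_one hp0 hp1 ?_) _
        have h1 := Finset.le_card_sdiff (S ∪ T) X
        have h2 := Finset.card_union_le S T
        omega
      · exact Finset.disjoint_sdiff.mono_left Finset.subset_union_left
    calc _ ≤ ∑ S ∈ X.powersetCard k, ∑ T ∈ X.powersetCard (2 * k), ((1 - p : ℝ) ^ r) ^ k :=
          (binomialRandom_exists_le p _ _).trans (Finset.sum_le_sum fun S hS =>
            (binomialRandom_exists_le p _ _).trans (Finset.sum_le_sum fun T hT => hST S hS T hT))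
      _ = (X.card.choose k : ℝ) * ((X.card.choose (2 * k) : ℝ) * ((1 - p : ℝ) ^ r) ^ k) := by
          simp [Finset.sum_const, Finset.card_powersetCard]
      _ ≤ (X.card : ℝ) ^ k * ((X.card : ℝ) ^ (2 * k) * ((1 - p : ℝ) ^ r) ^ k) := by
          gcongr
          · exact_mod_cast Nat.choose_le_pow _ _
          · exact_mod_cast Nat.choose_le_pow _ _
      _ = ((X.card : ℝ) ^ 3 * (1 - p : ℝ) ^ r) ^ k := by ring
      _ ≤ δ ^ k := pow_le_pow_left₀ (by positivity) hδ _
      _ ≤ δ := pow_le_of_le_one hδ0 hδ1 (by omega)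
  refine (Finset.sum_le_sum hterm).trans ?_
  rw [Finset.sum_const, nsmul_eq_mul]
  refine mul_le_mul_of_nonneg_right ?_ hδ0
  exact_mod_cast (Finset.card_filter_le _ _).trans (by simp)

/-- Split according to the value `A` of the set of starts: it is determined inside `X`, so the edges
from `x` to `A` are independent of it. -/
theorem binomialRandom_longestPathStarts_not_adj_le {X : Finset V} {s x : V} (hs : s ∈ X)
    (hx : x ∉ X) {q : ℕ} (hq : 5 * q ≤ X.card) :
    (binomialRandom V p).real {G | ∀ a ∈ longestPathStarts G X s, ¬ G.Adj x a} ≤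
      (binomialRandom V p).real {G | ¬ ExpandsIn G X} + (1 - p : ℝ) ^ q := by
  have hp0 : (0 : ℝ) ≤ 1 - p := sub_nonneg.2 p.2.2
  have hp1 : (1 - p : ℝ) ≤ 1 := sub_le_self _ p.2.1
  set I : Finset (Finset V) := X.powerset.filter fun A => q ≤ A.card
  have hstep : (binomialRandom V p).real {G | ∀ a ∈ longestPathStarts G X s, ¬ G.Adj x a} ≤
      (binomialRandom V p).real {G | ¬ ExpandsIn G X ∨
        ∃ A ∈ I, longestPathStarts G X s = A ∧ ∀ a ∈ A, ¬ G.Adj x a} := by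
    refine binomialRandom_mono p fun G hG => ?_
    by_cases h : ExpandsIn G X
    · refine Or.inr ⟨_, ?_, rfl, hG⟩
      have := h.card_lt hs
      simp only [I, Finset.mem_filter, Finset.mem_powerset]
      exact ⟨fun v hv => (mem_longestPathStarts.1 hv).1, by omega⟩
    · exact Or.inl h
  refine hstep.trans ((binomialRandom_or_le p _ _).trans (add_le_add le_rfl ?_))
  refine (binomialRandom_exists_le p _ _).trans ?_
  calc _ ≤ ∑ A ∈ I, (1 - p : ℝ) ^ q *
        (binomialRandom V p).real {G | longestPathStarts G X s = A} := by
        refine Finset.sum_le_sum fun A hA => ?_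
        simp only [I, Finset.mem_filter, Finset.mem_powerset] at hA
        rw [binomialRandom_and_forall_not_adj p (fun h => hx (hA.1 h)) (X := (X : Set V))]
        · exact mul_le_mul_of_nonneg_right (pow_le_pow_of_le_one hp0 hp1 hA.2)
            MeasureTheory.measureReal_nonneg
        · exact_mod_cast hx
        · intro G G' hG
          simp only [longestPathStarts_congr (s := s) (X := X) (G := G) (by exact_mod_cast hG)]
    _ = (1 - p : ℝ) ^ q * ∑ A ∈ I, (binomialRandom V p).real {G | longestPathStarts G X s = A} := by
        rw [Finset.mul_sum]
    _ ≤ (1 - p : ℝ) ^ q * 1 := by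
        refine mul_le_mul_of_nonneg_left ?_ (by positivity)
        rw [← MeasureTheory.measureReal_biUnion_finset]
        · exact MeasureTheory.measureReal_le_one
        · intro A _ B _ hAB
          refine Set.disjoint_left.2 fun G h1 h2 => hAB ?_
          exact h1.symm.trans h2
        · exact fun _ _ => measurableSet_simpleGraph _
    _ = (1 - p : ℝ) ^ q := mul_one _

theorem binomialRandom_not_hamiltonian_isPathInto_le {W : Finset V} {s z : V} (hs : s ∈ W)
    (hz : z ∉ W) {η : ℝ} {N : ℕ} (hW : W.card = N + 1)
    (hη : ∀ (X : Finset V) (s x : V), s ∈ X → x ∉ X → N ≤ X.card → X.card ≤ N + 1 →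
      (binomialRandom V p).real {G | ∀ a ∈ longestPathStarts G X s, ¬ G.Adj x a} ≤ η) :
    (binomialRandom V p).real {G | ¬ ∃ v t, IsPathInto G W s (v :: t) ∧
      (v :: t).toFinset = W ∧ G.Adj z v} ≤ (N + 1) * η := by
  have hstep : (binomialRandom V p).real {G | ¬ ∃ v t, IsPathInto G W s (v :: t) ∧
      (v :: t).toFinset = W ∧ G.Adj z v} ≤ (binomialRandom V p).real
        {G | (∃ x ∈ W.erase s, ∀ a ∈ longestPathStarts G (W.erase x) s, ¬ G.Adj x a) ∨
          ∀ a ∈ longestPathStarts G W s, ¬ G.Adj z a} := by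
    refine binomialRandom_mono p fun G hG => ?_
    contrapose! hG
    exact exists_hamiltonian_isPathInto hs hG.1 hG.2
  refine hstep.trans ((binomialRandom_or_le p _ _).trans ?_)
  rw [add_mul, one_mul]
  refine add_le_add ((binomialRandom_exists_le p _ _).trans ?_) (hη W s z hs hz (by omega) (by omega))
  calc _ ≤ ∑ x ∈ W.erase s, η := by
        refine Finset.sum_le_sum fun x hx => ?_
        rw [Finset.mem_erase] at hx
        have := Finset.card_erase_of_mem hx.2
        exact hη _ _ _ (Finset.mem_erase.2 ⟨hx.1.symm, hs⟩) (Finset.notMem_erase _ _)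
          (by omega) (by omega)
    _ = N * η := by simp [Finset.card_erase_of_mem hs, hW]

end Expansion

/-! ### The greedy walk and the tail of its inversion count. -/

section Greedy

open SimpleGraph

/-- The number of inversions of a list. -/
def List.inversions {α : Type*} [LinearOrder α] : List α → ℕ
  | [] => 0
  | a :: l => l.countP (fun b => b < a) + l.inversions

theorem List.inversions_le {α : Type*} [LinearOrder α] (l : List α) :
    l.inversions ≤ l.length ^ 2 := by
  induction l with
  | nil => simp [List.inversions]
  | cons a l ih =>
    have : l.countP (fun b => b < a) ≤ l.length := List.countP_le_length
    simp only [List.inversions, List.length_cons]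
    nlinarith

variable {V : Type*} [LinearOrder V]

/-- `G` has a path that starts at `s`, then runs through exactly the vertices of `U` with at most
`j` inversions among them, and ends at a neighbour of `z`. -/
def HasOrderedPath (G : SimpleGraph V) (z s : V) (U : Finset V) (j : ℕ) : Prop :=
  ∃ l : List V, (s :: l).IsChain G.Adj ∧ l.Nodup ∧ l.toFinset = U ∧
    (∃ b ∈ l.getLast?, G.Adj z b) ∧ l.inversions ≤ j

theorem HasOrderedPath.mono {G G' : SimpleGraph V} {z s : V} {U : Finset V} {j j' : ℕ}
    (h : HasOrderedPath G z s U j) (hj : j ≤ j')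
    (hG : ∀ a ∈ insert z (insert s U), ∀ b ∈ insert z (insert s U), G.Adj a b → G'.Adj a b) :
    HasOrderedPath G' z s U j' := by
  obtain ⟨l, h1, h2, h3, ⟨b, hb, h4⟩, h5⟩ := h
  have hl : ∀ a ∈ s :: l, a ∈ insert z (insert s U) := by
    intro a ha
    rw [← h3]
    simp only [List.mem_cons, Finset.mem_insert, List.mem_toFinset] at ha ⊢
    tauto
  exact ⟨l, h1.imp_of_mem_imp fun a b ha hb => hG a (hl a ha) b (hl b hb), h2, h3,
    ⟨b, hb, hG z (by simp) b (hl b (List.mem_cons_of_mem _ (List.mem_of_getLast? hb))) h4⟩, h5.trans hj⟩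

theorem dependsOnInduced_hasOrderedPath (z s : V) (U : Finset V) (j : ℕ) :
    DependsOnInduced (insert z (insert s U) : Finset V) fun G => ¬ HasOrderedPath G z s U j := by
  intro G G' hG
  refine not_congr ⟨fun h => h.mono le_rfl fun a ha b hb => (hG a ha b hb).1,
    fun h => h.mono le_rfl fun a ha b hb => (hG a ha b hb).2⟩

theorem HasOrderedPath.cons {G : SimpleGraph V} {z s u : V} {U : Finset V} {j : ℕ} (hu : u ∈ U)
    (hsu : G.Adj s u) (h : HasOrderedPath G z u (U.erase u) j) :
    HasOrderedPath G z s U ((U.filter (· < u)).card + j) := by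
  obtain ⟨l, h1, h2, h3, ⟨b, hb, h4⟩, h5⟩ := h
  have hul : u ∉ l := by
    rw [← List.mem_toFinset, h3]; simp
  refine ⟨u :: l, List.isChain_cons_cons.2 ⟨hsu, h1⟩, List.nodup_cons.2 ⟨hul, h2⟩, ?_, ⟨b, ?_, h4⟩, ?_⟩
  · rw [List.toFinset_cons, h3, Finset.insert_erase hu]
  · cases l with
    | nil => simp at hb
    | cons c l => rwa [List.getLast?_cons_cons]
  · simp only [List.inversions]
    refine add_le_add ?_ h5
    rw [List.countP_eq_length_filter, ← List.toFinset_card_of_nodup (h2.filter _)]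
    refine Finset.card_le_card fun a ha => ?_
    simp only [List.mem_toFinset, List.mem_filter, decide_eq_true_eq, Finset.mem_filter] at ha ⊢
    refine ⟨?_, ha.2⟩
    have : a ∈ l.toFinset := List.mem_toFinset.2 ha.1
    rw [h3] at this
    exact Finset.mem_of_mem_erase this

theorem IsPathInto.hasOrderedPath {G : SimpleGraph V} {z s v : V} {t : List V} {U : Finset V}
    (hsU : s ∉ U) (hU : U.Nonempty) (h : IsPathInto G (insert s U) s (v :: t))
    (ht : (v :: t).toFinset = insert s U) (hzv : G.Adj z v) :
    HasOrderedPath G z s U (U.card ^ 2) := by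
  obtain ⟨h1, h2, -, h4⟩ := h
  obtain ⟨l, hl⟩ : ∃ l, v :: t = l ++ [s] := by
    obtain ⟨l, x, hx⟩ := (List.eq_nil_or_concat' (v :: t)).resolve_left (by simp)
    rw [hx] at h4
    simp only [List.getLast?_append, List.getLast?_singleton, Option.some_or, Option.some.injEq] at h4
    exact ⟨l, h4 ▸ hx⟩
  rw [hl] at h1 h2 ht
  have hsl : s ∉ l := fun hs => by
    rw [List.nodup_append] at h2
    exact h2.2.2 s hs s (by simp) rfl
  have hlU : l.toFinset = U := by
    ext a
    have := congrArg (a ∈ ·) ht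
    simp only [List.toFinset_append, List.toFinset_cons, List.toFinset_nil, Finset.mem_union,
      List.mem_toFinset, Finset.mem_insert, Finset.notMem_empty, or_false, eq_iff_iff] at this ⊢
    constructor
    · intro ha
      exact (this.1 (Or.inl ha)).resolve_left (by rintro rfl; exact hsl ha)
    · intro ha
      exact (this.2 (Or.inr ha)).resolve_right (by rintro rfl; exact hsU ha)
  have hnd : l.Nodup := (List.nodup_append.1 h2).1
  have hlen : l.length = U.card := by rw [← List.toFinset_card_of_nodup hnd, hlU]
  refine ⟨l.reverse, ?_, List.nodup_reverse.2 hnd, by simpa using hlU, ⟨v, ?_, hzv⟩, ?_⟩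
  · have : s :: l.reverse = (l ++ [s]).reverse := by simp
    rw [this, List.isChain_reverse]
    exact h1.imp fun _ _ h => h.symm
  · cases l with
    | nil => simp at hlU; exact absurd hU (by simp [← hlU])
    | cons a l => simp at hl ⊢; exact hl.1.symm
  · refine (List.inversions_le _).trans ?_
    simp [hlen]

/-- The ranks of the elements of `U` are exactly `0, …, |U| - 1`. -/
theorem sum_card_filter_lt (U : Finset V) (f : ℕ → ℝ) :
    ∑ u ∈ U, f (U.filter (· < u)).card = ∑ k ∈ Finset.range U.card, f k := by
  induction U using Finset.induction_on_max with
  | empty => simp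
  | insert a U ha ih =>
    have haU : a ∉ U := fun h => lt_irrefl _ (ha a h)
    rw [Finset.sum_insert haU, Finset.card_insert_of_notMem haU, Finset.sum_range_succ, ← ih, add_comm]
    congr 1
    · refine Finset.sum_congr rfl fun u hu => ?_
      rw [Finset.filter_insert, if_neg (ha u hu).not_gt]
    · rw [Finset.filter_insert, if_neg (lt_irrefl _), Finset.filter_true_of_mem ha]

theorem mul_geom_sum_le {q r : ℝ} (hq : 0 ≤ q) (hr : 0 ≤ r) (hr1 : r < 1) {c : ℝ}
    (hc : q ≤ c * (1 - r)) (n : ℕ) : q * ∑ k ∈ Finset.range n, r ^ k ≤ c := by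
  have h1 : (1 - r) * ∑ k ∈ Finset.range n, r ^ k ≤ 1 := by
    rw [mul_neg_geom_sum]
    linarith [pow_nonneg hr n]
  have h2 : 0 ≤ ∑ k ∈ Finset.range n, r ^ k := Finset.sum_nonneg fun k _ => pow_nonneg hr k
  have hc0 : 0 ≤ c := by
    by_contra! h
    nlinarith
  nlinarith

theorem hasOrderedPath_of_first_neighbour {G : SimpleGraph V} {z s : V} {U : Finset V} {j i : ℕ}
    (hs : ∃ u ∈ U, G.Adj s u)
    (h : ∀ u ∈ U, (∀ b ∈ U.filter (· < u), ¬ G.Adj s b) → G.Adj s u →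
      (U.filter (· < u)).card ≤ j ∧
        HasOrderedPath G z u (U.erase u) (j - (U.filter (· < u)).card + i)) :
    HasOrderedPath G z s U (j + i) := by
  classical
  have hne : (U.filter (G.Adj s)).Nonempty := by
    obtain ⟨u, hu, hsu⟩ := hs
    exact ⟨u, Finset.mem_filter.2 ⟨hu, hsu⟩⟩
  have hu := Finset.mem_filter.1 (Finset.min'_mem _ hne)
  obtain ⟨h1, h2⟩ := h _ hu.1 (fun b hb hsb => by
    rw [Finset.mem_filter] at hb
    exact absurd hb.2 (Finset.min'_le _ b (Finset.mem_filter.2 ⟨hb.1, hsb⟩)).not_gt) hu.2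
  exact (h2.cons hu.1 hu.2).mono (by omega) fun _ _ _ _ h => h

variable [Fintype V] (p : unitInterval)

/-- A Chernoff bound by induction: with base `(1 - p / 2)⁻¹`, each geometric cost contributes a
factor at most `∑ p (1 - p / 2) ^ b ≤ 2`. The remaining terms cover a step without a neighbour and
failure of the final path. -/
theorem binomialRandom_not_hasOrderedPath_le (hp : 0 < (p : ℝ)) {z : V} {N : ℕ} {ε : ℝ} (hε : 0 ≤ ε)
    (hbase : ∀ (U : Finset V) (s : V), U.card = N → s ∉ U → z ∉ U → s ≠ z →
      (binomialRandom V p).real {G | ¬ HasOrderedPath G z s U (N ^ 2)} ≤ ε)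
    (m : ℕ) : ∀ (U : Finset V) (s : V) (j : ℕ), U.card = N + m → s ∉ U → z ∉ U → s ≠ z →
      (binomialRandom V p).real {G | ¬ HasOrderedPath G z s U (j + N ^ 2)} ≤
        2 ^ m * (1 - p / 2 : ℝ) ^ j + (m * (1 - p : ℝ) ^ N + ε) := by
  have hp1 : (p : ℝ) ≤ 1 := p.2.2
  have hq0 : (0 : ℝ) ≤ 1 - p := by linarith
  have hr0 : (0 : ℝ) ≤ 1 - p / 2 := by linarith
  have hr1 : (1 - p / 2 : ℝ) ≤ 1 := by linarith
  induction m with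
  | zero =>
    intro U s j hU hs hz hsz
    have h1 := hbase U s hU hs hz hsz
    have h2 : (binomialRandom V p).real {G | ¬ HasOrderedPath G z s U (j + N ^ 2)} ≤
        (binomialRandom V p).real {G | ¬ HasOrderedPath G z s U (N ^ 2)} :=
      binomialRandom_mono p fun G hG h => hG (h.mono (by omega) fun _ _ _ _ h => h)
    have h3 : (0 : ℝ) ≤ (1 - p / 2 : ℝ) ^ j := pow_nonneg hr0 _
    simp only [pow_zero, one_mul, Nat.cast_zero, zero_mul, zero_add]
    linarith
  | succ m ih =>
    intro U s j hU hs hz hsz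
    set c : ℝ := m * (1 - p : ℝ) ^ N + ε with hc
    have hc0 : 0 ≤ c := by positivity
    let B : V → Finset V := fun u => U.filter (· < u)
    -- If the step to `u` alone exceeds the budget `j`, then `F u` holds vacuously and counts as a
    -- failure.
    let F : V → SimpleGraph V → Prop := fun u G =>
      (B u).card ≤ j → ¬ HasOrderedPath G z u (U.erase u) (j - (B u).card + N ^ 2)
    have hstep : (binomialRandom V p).real {G | ¬ HasOrderedPath G z s U (j + N ^ 2)} ≤
        (binomialRandom V p).real {G | (True ∧ ∀ u ∈ U, ¬ G.Adj s u) ∨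
          ∃ u ∈ U, (F u G ∧ ∀ b ∈ B u, ¬ G.Adj s b) ∧ G.Adj s u} := by
      refine binomialRandom_mono p fun G hG => ?_
      contrapose! hG
      refine hasOrderedPath_of_first_neighbour (by simpa using hG.1) fun u hu hub hsu => ?_
      by_contra hcon
      refine hG.2 u hu ⟨fun hle h => hcon ⟨hle, h⟩, hub⟩ hsu
    have hfirst : (binomialRandom V p).real {G | True ∧ ∀ u ∈ U, ¬ G.Adj s u} ≤ (1 - p : ℝ) ^ N := by
      rw [binomialRandom_and_forall_not_adj p hs (X := ∅) (by simp) fun _ _ _ => Iff.rfl]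
      refine (mul_le_of_le_one_right (by positivity) MeasureTheory.measureReal_le_one).trans ?_
      exact pow_le_pow_of_le_one hq0 (by linarith) (by omega)
    have hterm : ∀ u ∈ U, (binomialRandom V p).real
        {G | (F u G ∧ ∀ b ∈ B u, ¬ G.Adj s b) ∧ G.Adj s u} ≤
        2 ^ m * (1 - p / 2 : ℝ) ^ j * (p * (1 - p / 2 : ℝ) ^ (B u).card) +
          c * (p * (1 - p : ℝ) ^ (B u).card) := by
      intro u hu
      have hsu : s ≠ u := fun h => hs (h ▸ hu)
      rw [binomialRandom_and_adj_and_forall_not_adj p (X := (insert z U : Finset V))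
        (fun h => hs (Finset.mem_filter.1 h).1) hsu (by simp) (by simp [hs, hsz])]
      -- One of the two factors `(1 - p / 2) ^ |B u|` restores the budget spent, the other makes the
      -- sum over `u` converge.
      · have hsq : (1 - p : ℝ) ^ (B u).card ≤ (1 - p / 2 : ℝ) ^ (2 * (B u).card) := by
          rw [pow_mul]
          exact pow_le_pow_left₀ hq0 (by nlinarith) _
        have hqk : (0 : ℝ) ≤ (1 - p : ℝ) ^ (B u).card := by positivity
        have hmain : (1 - p : ℝ) ^ (B u).card * (binomialRandom V p).real {G | F u G} ≤
            2 ^ m * (1 - p / 2 : ℝ) ^ (j + (B u).card) + c * (1 - p : ℝ) ^ (B u).card := by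
          by_cases hle : (B u).card ≤ j
          · have h1 : (binomialRandom V p).real {G | F u G} ≤
                2 ^ m * (1 - p / 2 : ℝ) ^ (j - (B u).card) + c := by
              have hF : {G | F u G} =
                  {G | ¬ HasOrderedPath G z u (U.erase u) (j - (B u).card + N ^ 2)} := by
                ext G; simp [F, hle]
              rw [hF]
              refine ih _ u _ ?_ (by simp) (fun h => hz (Finset.mem_of_mem_erase h))
                (fun h => hz (h ▸ hu))
              rw [Finset.card_erase_of_mem hu]; omega
            calc _ ≤ (1 - p : ℝ) ^ (B u).card *
                  (2 ^ m * (1 - p / 2 : ℝ) ^ (j - (B u).card) + c) :=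
                  mul_le_mul_of_nonneg_left h1 hqk
              _ = 2 ^ m * ((1 - p : ℝ) ^ (B u).card * (1 - p / 2 : ℝ) ^ (j - (B u).card)) +
                  c * (1 - p : ℝ) ^ (B u).card := by ring
              _ ≤ 2 ^ m * ((1 - p / 2 : ℝ) ^ (2 * (B u).card) *
                  (1 - p / 2 : ℝ) ^ (j - (B u).card)) + c * (1 - p : ℝ) ^ (B u).card := by
                  gcongr
              _ = _ := by
                  rw [← pow_add]
                  congr 3
                  omega
          · have h1 : (1 - p : ℝ) ^ (B u).card * (binomialRandom V p).real {G | F u G} ≤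
                (1 - p : ℝ) ^ (B u).card :=
              mul_le_of_le_one_right hqk MeasureTheory.measureReal_le_one
            have h2 : (1 - p / 2 : ℝ) ^ (2 * (B u).card) ≤ (1 - p / 2 : ℝ) ^ (j + (B u).card) :=
              pow_le_pow_of_le_one hr0 hr1 (by omega)
            have h3 : (0 : ℝ) ≤ (1 - p / 2 : ℝ) ^ (j + (B u).card) := by positivity
            have h4 : (1 : ℝ) ≤ 2 ^ m := one_le_pow₀ (by norm_num)
            have h5 : 0 ≤ c * (1 - p : ℝ) ^ (B u).card := by positivity
            nlinarith
        calc _ ≤ (p : ℝ) * (2 ^ m * (1 - p / 2 : ℝ) ^ (j + (B u).card) +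
              c * (1 - p : ℝ) ^ (B u).card) := mul_le_mul_of_nonneg_left hmain hp.le
          _ = _ := by rw [pow_add]; ring
      · intro G G' hG
        refine imp_congr_right fun _ => dependsOnInduced_hasOrderedPath z u _ _ G G' ?_
        rw [Finset.insert_erase hu]
        exact hG
    have hsum1 : (p : ℝ) * ∑ k ∈ Finset.range U.card, (1 - p / 2 : ℝ) ^ k ≤ 2 :=
      mul_geom_sum_le hp.le hr0 (by linarith) (by linarith) _
    have hsum2 : (p : ℝ) * ∑ k ∈ Finset.range U.card, (1 - p : ℝ) ^ k ≤ 1 :=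
      mul_geom_sum_le hp.le hq0 (by linarith) (by linarith) _
    calc _ ≤ (1 - p : ℝ) ^ N + ∑ u ∈ U, (2 ^ m * (1 - p / 2 : ℝ) ^ j *
          (p * (1 - p / 2 : ℝ) ^ (B u).card) + c * (p * (1 - p : ℝ) ^ (B u).card)) :=
          hstep.trans ((binomialRandom_or_le p _ _).trans (add_le_add hfirst
            ((binomialRandom_exists_le p _ _).trans (Finset.sum_le_sum hterm))))
      _ = (1 - p : ℝ) ^ N + (2 ^ m * (1 - p / 2 : ℝ) ^ j *
          (p * ∑ k ∈ Finset.range U.card, (1 - p / 2 : ℝ) ^ k) +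
            c * (p * ∑ k ∈ Finset.range U.card, (1 - p : ℝ) ^ k)) := by
          rw [sum_card_filter_lt U fun k => 2 ^ m * (1 - p / 2 : ℝ) ^ j *
            (p * (1 - p / 2 : ℝ) ^ k) + c * (p * (1 - p : ℝ) ^ k)]
          simp only [Finset.sum_add_distrib, Finset.mul_sum]
      _ ≤ (1 - p : ℝ) ^ N + (2 ^ m * (1 - p / 2 : ℝ) ^ j * 2 + c * 1) := by gcongr
      _ = _ := by rw [hc]; push_cast; ring

end Greedy

/-! ### From ordered paths to Hamilton cycles. -/

section HamiltonCycle

open SimpleGraph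

theorem List.countP_ofFn_eq_sum {α : Type*} (q : α → Bool) {n : ℕ} (f : Fin n → α) :
    (List.ofFn f).countP q = ∑ i, if q (f i) then 1 else 0 := by
  induction n with
  | zero => simp
  | succ n ih => rw [List.ofFn_succ, List.countP_cons, ih, Fin.sum_univ_succ, add_comm]

theorem List.inversions_ofFn {α : Type*} [LinearOrder α] {n : ℕ} (f : Fin n → α) :
    (List.ofFn f).inversions =
      (Finset.univ.filter fun q : Fin n × Fin n => q.1 < q.2 ∧ f q.2 < f q.1).card := by
  rw [Finset.card_filter, Fintype.sum_prod_type]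
  induction n with
  | zero => simp [List.inversions]
  | succ n ih =>
    rw [List.ofFn_succ, List.inversions, ih, Fin.sum_univ_succ]
    congr 1
    · rw [List.countP_ofFn_eq_sum, Fin.sum_univ_succ]
      simp
    · refine Finset.sum_congr rfl fun i _ => ?_
      rw [Fin.sum_univ_succ]
      simp

theorem HasOrderedPath.hasHamiltonCycleWithInversionsLE {n : ℕ} (hn : 3 ≤ n)
    {G : SimpleGraph (Fin n)} {z a : Fin n} (hz : (z : ℕ) = 0) (hza : G.Adj z a) {j : ℕ}
    (h : HasOrderedPath G z a ((Finset.univ.erase z).erase a) j) :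
    HasHamiltonCycleWithInversionsLE G (n + j : ℕ) := by
  obtain ⟨l, h1, h2, h3, ⟨b, hb, h4⟩, h5⟩ := h
  have hmem : ∀ x, x ∈ l ↔ x ≠ a ∧ x ≠ z := by
    intro x
    rw [← List.mem_toFinset, h3]
    simp
  have hlen : l.length + 2 = n := by
    rw [← List.toFinset_card_of_nodup h2, h3, Finset.card_erase_of_mem (by simp [hza.ne']),
      Finset.card_erase_of_mem (by simp)]
    simp
    omega
  have hchain : (a :: l ++ [z]).IsChain G.Adj := by
    rw [List.isChain_append]
    refine ⟨h1, by simp, ?_⟩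
    have hlast : (a :: l).getLast? = some b := by
      cases l with
      | nil => simp at hb
      | cons c l => rwa [List.getLast?_cons_cons]
    simp [hlast, h4.symm]
  obtain ⟨w, hw⟩ : ∃ w : G.Walk a z, w.support = a :: l ++ [z] :=
    ⟨(Walk.ofSupport _ (by simp) hchain).copy (by simp) (by simp),
      (Walk.support_copy _ _ _).trans (Walk.support_ofSupport _ _)⟩
  have hwlen : w.length + 1 = n := by
    rw [← w.length_support, hw]
    simpa using hlen
  have hpath : w.IsPath := by
    refine Walk.IsPath.mk' ?_
    rw [hw, List.nodup_append]
    refine ⟨List.nodup_cons.2 ⟨fun ha => ((hmem a).1 ha).1 rfl, h2⟩, by simp, ?_⟩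
    rintro x hx y hy rfl
    obtain rfl : x = z := by simpa using hy
    rcases List.mem_cons.1 hx with h | h
    · exact hza.ne h
    · exact ((hmem x).1 h).2 rfl
  refine ⟨z, Walk.cons hza w, hz, ?_, ?_⟩
  · rw [Walk.isHamiltonianCycle_iff_isCycle_and_length_eq,
      Walk.isCycle_iff_isPath_tail_and_le_length]
    simp [hpath, hwlen, hn]
  · have hof : List.ofFn (fun i : Fin n => (Walk.cons hza w).getVert i) = z :: a :: l := by
      refine List.ext_getElem (by simp [hlen]) fun i hi hi' => ?_
      rw [List.length_ofFn] at hi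
      rw [List.getElem_ofFn, Walk.getVert_eq_support_getElem _ (by simp; omega)]
      have hsupp : (Walk.cons hza w).support = (z :: a :: l) ++ [z] := by simp [hw]
      simp only [hsupp]
      rw [List.getElem_append_left]
    have hz0 : ∀ L : List (Fin n), L.countP (fun b => b < z) = 0 := by
      intro L
      rw [List.countP_eq_zero]
      intro x _
      simp [Fin.lt_def, hz]
    have hca : l.countP (fun b => b < a) ≤ l.length := List.countP_le_length
    have : cycleInversions (Walk.cons hza w) ≤ n + j := by
      unfold cycleInversions
      rw [← List.inversions_ofFn (fun i : Fin n => (Walk.cons hza w).getVert i), hof]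
      simp only [List.inversions, hz0]
      omega
    exact_mod_cast this

theorem HasHamiltonCycleWithInversionsLE.mono {n : ℕ} {G : SimpleGraph (Fin n)} {M M' : ℝ}
    (h : HasHamiltonCycleWithInversionsLE G M) (hM : M ≤ M') :
    HasHamiltonCycleWithInversionsLE G M' := by
  obtain ⟨a, c, h1, h2, h3⟩ := h
  exact ⟨a, c, h1, h2, h3.trans hM⟩

/-- A neighbour of `z` is needed as second vertex: the path from vertex `1` ends at one, and the
path from that neighbour closes the cycle. -/
theorem hasHamiltonCycleWithInversionsLE_of_forall {n : ℕ} (hn : 3 ≤ n)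
    {G : SimpleGraph (Fin n)} {z : Fin n} (hz : (z : ℕ) = 0) {j : ℕ}
    (h : ∀ a ∈ Finset.univ.erase z, HasOrderedPath G z a ((Finset.univ.erase z).erase a) j) :
    HasHamiltonCycleWithInversionsLE G (n + j : ℕ) := by
  have h1 : (⟨1, by omega⟩ : Fin n) ∈ Finset.univ.erase z := by
    simp [Fin.ext_iff, hz]
  obtain ⟨l, -, -, h3, ⟨b, hb, hzb⟩, -⟩ := h _ h1
  have hbz : b ∈ Finset.univ.erase z := by simp [hzb.ne']
  exact (h b hbz).hasHamiltonCycleWithInversionsLE hn hz hzb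

theorem binomialRandom_longestPathStarts_le_of_pow_le {n : ℕ} (p : unitInterval) {k : ℕ} {β : ℝ}
    (hn : 1 ≤ n) (hβ : (1 - p : ℝ) ^ k ≤ β) (hβn : β * n ^ 6 ≤ 1) (X : Finset (Fin n))
    (s x : Fin n) (hs : s ∈ X) (hx : x ∉ X) (hk : 5 * k ≤ X.card) :
    (binomialRandom (Fin n) p).real {G | ∀ a ∈ longestPathStarts G X s, ¬ G.Adj x a} ≤ 2 * β := by
  have hp0 : (0 : ℝ) ≤ 1 - p := sub_nonneg.2 p.2.2
  have hβ0 : 0 ≤ β := le_trans (by positivity) hβ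
  have hn1 : (1 : ℝ) ≤ n := by exact_mod_cast hn
  have hXn : (X.card : ℝ) ≤ n := by exact_mod_cast (Finset.card_le_univ X).trans (by simp)
  -- Taking `r = 2 k` squares `β`, which absorbs the polynomial factors of the union bound.
  have hexp := binomialRandom_not_expandsIn_le p (X := X) (r := 2 * k) (by omega)
    (δ := n ^ 3 * β ^ 2) (by rw [mul_comm 2 k, pow_mul]; gcongr) (by
      have h1 : β * (n : ℝ) ^ 3 ≤ 1 := le_trans (by gcongr; norm_num) hβn
      have h2 : β ≤ 1 := le_trans (le_mul_of_one_le_right hβ0 (one_le_pow₀ hn1)) hβn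
      calc (n : ℝ) ^ 3 * β ^ 2 = β * (β * n ^ 3) := by ring
        _ ≤ 1 * 1 := by gcongr
        _ = 1 := one_mul 1)
  have h4 : (n : ℝ) * (n ^ 3 * β ^ 2) ≤ β := by
    have h1 : β * (n : ℝ) ^ 4 ≤ 1 := le_trans (by gcongr; norm_num) hβn
    calc (n : ℝ) * (n ^ 3 * β ^ 2) = β * (β * n ^ 4) := by ring
      _ ≤ β * 1 := by gcongr
      _ = β := mul_one β
  have h5 : (X.card : ℝ) * (n ^ 3 * β ^ 2) ≤ n * (n ^ 3 * β ^ 2) := by gcongr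
  have := binomialRandom_longestPathStarts_not_adj_le p hs hx hk
  linarith

theorem binomialRandom_not_hasHamiltonCycle_le {n : ℕ} (p : unitInterval) (hp : 0 < (p : ℝ))
    {k j : ℕ} {β : ℝ} (hk : 1 ≤ k) (hkn : 5 * k + 2 ≤ n) (hβ : (1 - p : ℝ) ^ k ≤ β)
    (hβn : β * n ^ 6 ≤ 1) :
    (binomialRandom (Fin n) p).real
      {G | ¬ HasHamiltonCycleWithInversionsLE G (n + (j + (5 * k) ^ 2) : ℕ)} ≤
      n * (2 ^ n * (1 - p / 2 : ℝ) ^ j + 3 * n * β) := by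
  have hp1 : (p : ℝ) ≤ 1 := p.2.2
  have hp0 : (0 : ℝ) ≤ 1 - p := by linarith
  have hβ0 : 0 ≤ β := le_trans (by positivity) hβ
  have hr0 : (0 : ℝ) ≤ 1 - p / 2 := by linarith
  let z : Fin n := ⟨0, by omega⟩
  have hbase : ∀ (U : Finset (Fin n)) (s : Fin n), U.card = 5 * k → s ∉ U → z ∉ U → s ≠ z →
      (binomialRandom (Fin n) p).real {G | ¬ HasOrderedPath G z s U ((5 * k) ^ 2)} ≤
        2 * n * β := by
    intro U s hU hs hz hsz
    have hU0 : U.Nonempty := Finset.card_pos.1 (by omega)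
    have h1 := binomialRandom_not_hamiltonian_isPathInto_le p (W := insert s U) (s := s) (z := z)
      (η := 2 * β) (N := 5 * k) (by simp) (by simp [hz, hsz.symm])
      (by rw [Finset.card_insert_of_notMem hs, hU])
      (fun X s x hsX hxX h5 _ =>
        binomialRandom_longestPathStarts_le_of_pow_le p (by omega) hβ hβn X s x hsX hxX h5)
    have h2 : ((5 * k : ℕ) + 1 : ℝ) ≤ n := by
      have : 5 * k + 1 ≤ n := by omega
      exact_mod_cast this
    refine (binomialRandom_mono p fun G hG => ?_).trans (h1.trans ?_)
    · rintro ⟨v, t, hvt, hW, hzv⟩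
      exact hG (hU ▸ hvt.hasOrderedPath hs hU0 hW hzv)
    · calc ((5 * k : ℕ) + 1 : ℝ) * (2 * β) ≤ n * (2 * β) := by gcongr
        _ = 2 * n * β := by ring
  have hmain : ∀ a ∈ Finset.univ.erase z, (binomialRandom (Fin n) p).real
      {G | ¬ HasOrderedPath G z a ((Finset.univ.erase z).erase a) (j + (5 * k) ^ 2)} ≤
        2 ^ n * (1 - p / 2 : ℝ) ^ j + 3 * n * β := by
    intro a ha
    have hcard : ((Finset.univ.erase z).erase a).card = 5 * k + (n - 2 - 5 * k) := by
      rw [Finset.card_erase_of_mem ha, Finset.card_erase_of_mem (by simp)]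
      simp
      omega
    have h1 := binomialRandom_not_hasOrderedPath_le p hp (z := z) (by positivity) hbase _ _ a j
      hcard (by simp) (by simp) (Finset.ne_of_mem_erase ha)
    refine h1.trans ?_
    have h2 : (1 - p : ℝ) ^ (5 * k) ≤ β :=
      (pow_le_pow_of_le_one hp0 (by linarith) (by omega)).trans hβ
    have h3 : ((n - 2 - 5 * k : ℕ) : ℝ) ≤ n := by
      have : n - 2 - 5 * k ≤ n := by omega
      exact_mod_cast this
    have h4 : (2 : ℝ) ^ (n - 2 - 5 * k) ≤ 2 ^ n := pow_le_pow_right₀ (by norm_num) (by omega)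
    calc _ ≤ 2 ^ n * (1 - p / 2 : ℝ) ^ j + (n * β + 2 * n * β) := by gcongr
      _ = _ := by ring
  calc _ ≤ (binomialRandom (Fin n) p).real {G | ∃ a ∈ Finset.univ.erase z,
        ¬ HasOrderedPath G z a ((Finset.univ.erase z).erase a) (j + (5 * k) ^ 2)} := by
        refine binomialRandom_mono p fun G hG => ?_
        contrapose! hG
        exact hasHamiltonCycleWithInversionsLE_of_forall (by omega) rfl hG
    _ ≤ ∑ a ∈ Finset.univ.erase z, (2 ^ n * (1 - p / 2 : ℝ) ^ j + 3 * n * β) :=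
        (binomialRandom_exists_le p _ _).trans (Finset.sum_le_sum hmain)
    _ ≤ n * (2 ^ n * (1 - p / 2 : ℝ) ^ j + 3 * n * β) := by
        rw [Finset.sum_const, nsmul_eq_mul]
        refine mul_le_mul_of_nonneg_right ?_ (by positivity)
        exact_mod_cast (Finset.card_le_univ _).trans (by simp)

end HamiltonCycle

/-! ### Choice of parameters. -/

section Asymptotics

open SimpleGraph

theorem one_sub_pow_le_exp_neg {t : ℝ} (ht : t ≤ 1) {k : ℕ} {c : ℝ} (hc : c ≤ t * k) :
    (1 - t) ^ k ≤ Real.exp (-c) := by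
  calc (1 - t) ^ k ≤ Real.exp (-t) ^ k :=
        pow_le_pow_left₀ (by linarith) (Real.one_sub_le_exp_neg t) _
    _ = Real.exp (-(t * k)) := by rw [← Real.exp_nat_mul]; ring_nf
    _ ≤ Real.exp (-c) := Real.exp_le_exp.2 (by linarith)

/-- If `n p ≥ 100 log² n`, a Hamilton cycle with at most `100 n / p` inversions exists with
probability at least `1 - 5 / n`. -/
theorem binomialRandom_not_hasHamiltonCycle_le_div {n : ℕ} (p : unitInterval) (hp : 0 < (p : ℝ))
    (hn : 4 ≤ n) (hlog : 1 ≤ Real.log n) (hnp : 100 * Real.log n ^ 2 ≤ n * p) :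
    (binomialRandom (Fin n) p).real
      {G | ¬ HasHamiltonCycleWithInversionsLE G (100 * n / p)} ≤ 5 / n := by
  set L := Real.log n
  have hp1 : (p : ℝ) ≤ 1 := p.2.2
  have hn0 : (4 : ℝ) ≤ n := by exact_mod_cast hn
  -- This `k` gives `(1 - p) ^ k ≤ n⁻⁶`, and `j` below gives `(1 - p / 2) ^ j ≤ exp (-2 n)`, which
  -- beats `2 ^ n`.
  set k := ⌈6 * (L / p)⌉₊
  set j := ⌈4 * ((n : ℝ) / p)⌉₊
  have hLp : 1 ≤ L / p := (one_le_div hp).2 (by linarith)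
  have hk1 : 6 * (L / p) ≤ k := Nat.le_ceil _
  have hk2 : (k : ℝ) ≤ 7 * (L / p) := by
    have := (Nat.ceil_lt_add_one (a := 6 * (L / p)) (by positivity)).le
    linarith
  have hy : (n : ℝ) ≤ n / p := by
    rw [le_div_iff₀ hp]; nlinarith
  have hj1 : 4 * ((n : ℝ) / p) ≤ j := Nat.le_ceil _
  have hj2 : (j : ℝ) ≤ 5 * (n / p) := by
    have := (Nat.ceil_lt_add_one (a := 4 * ((n : ℝ) / p)) (by positivity)).le
    linarith
  have hLn : 100 * (L / p) ≤ n := by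
    rw [← mul_div_assoc, div_le_iff₀ hp]
    nlinarith
  have hLn2 : 100 * (L / p) ^ 2 ≤ n / p := by
    rw [div_pow, ← mul_div_assoc, div_le_div_iff₀ (by positivity) hp]
    nlinarith
  have hkn : 5 * k + 2 ≤ n := by
    have : (5 * k + 2 : ℝ) ≤ n := by linarith
    exact_mod_cast this
  have hkpos : 1 ≤ k := by
    have : (1 : ℝ) ≤ k := by
      linarith
    exact_mod_cast this
  have hM : ((n + (j + (5 * k) ^ 2) : ℕ) : ℝ) ≤ 100 * n / p := by
    push_cast
    have : (5 * (k : ℝ)) ^ 2 ≤ 25 * (7 * (L / p)) ^ 2 := by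
      rw [mul_pow]; norm_num; gcongr
    rw [mul_div_assoc]
    nlinarith
  have hβ : (1 - p : ℝ) ^ k ≤ Real.exp (-(6 * L)) := by
    refine one_sub_pow_le_exp_neg hp1 ?_
    rwa [← mul_div_assoc, div_le_iff₀' hp] at hk1
  have hexp : Real.exp (-(6 * L)) * n ^ 6 = 1 := by
    have : (n : ℝ) ^ 6 = Real.exp (6 * L) := by
      rw [show (6 * L : ℝ) = (6 : ℕ) * L by norm_num, Real.exp_nat_mul,
        Real.exp_log (by linarith)]
    rw [this, ← Real.exp_add]
    simp
  have hr : (1 - p / 2 : ℝ) ^ j ≤ Real.exp (-(2 * n)) := by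
    refine one_sub_pow_le_exp_neg (by linarith) ?_
    rw [← mul_div_assoc, div_le_iff₀' hp] at hj1
    linarith
  have h2 : (2 : ℝ) ^ n * Real.exp (-(2 * n)) ≤ 2 / n ^ 2 := by
    have h3 : (2 : ℝ) ^ n ≤ Real.exp n := by
      have := pow_le_pow_left₀ (by norm_num) (Real.add_one_le_exp 1) n
      rw [← Real.exp_nat_mul] at this
      norm_num at this
      exact this
    calc (2 : ℝ) ^ n * Real.exp (-(2 * n)) ≤ Real.exp n * Real.exp (-(2 * n)) := by gcongr
      _ = (Real.exp n)⁻¹ := by rw [← Real.exp_add, ← Real.exp_neg]; ring_nf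
      _ ≤ ((n : ℝ) ^ 2 / 2)⁻¹ := by
          refine inv_anti₀ (by positivity) ?_
          have := Real.quadratic_le_exp_of_nonneg (x := n) (by positivity)
          linarith
      _ = 2 / n ^ 2 := by rw [inv_div]
  have hmain := binomialRandom_not_hasHamiltonCycle_le p hp (j := j) hkpos hkn hβ hexp.le
  refine (binomialRandom_mono p fun G hG h => hG (h.mono hM)).trans (hmain.trans ?_)
  have hβeq : Real.exp (-(6 * L)) = 1 / (n : ℝ) ^ 6 := by
    rw [eq_div_iff (by positivity), hexp]
  have h6 : 3 * (n : ℝ) * Real.exp (-(6 * L)) ≤ 3 / n ^ 2 := by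
    rw [hβeq, mul_one_div, div_le_div_iff₀ (by positivity) (by positivity)]
    have : (n : ℝ) ^ 3 ≤ n ^ 6 := pow_le_pow_right₀ (by linarith) (by norm_num)
    nlinarith
  calc (n : ℝ) * (2 ^ n * (1 - p / 2 : ℝ) ^ j + 3 * n * Real.exp (-(6 * L)))
      ≤ n * (2 ^ n * Real.exp (-(2 * n)) + 3 / n ^ 2) := by gcongr
    _ ≤ n * (2 / n ^ 2 + 3 / n ^ 2) := by gcongr
    _ = 5 / n := by field_simp; norm_num

end Asymptotics
theorem theorem7 (K : ℝ) (hK : 0 < K) (M : ℕ → ℝ) (p : ℕ → unitInterval)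
    (hM : ∀ᶠ n : ℕ in Filter.atTop,
      0 < M n ∧ M n ≤ K * (n : ℝ) ^ 2 / Real.log (n : ℝ) ^ 2)
    (hp : ∀ᶠ n : ℕ in Filter.atTop, 100 * max K 1 * (n : ℝ) / M n ≤ (p n : ℝ)) :
    Filter.Tendsto
      (fun n : ℕ => SimpleGraph.binomialRandom (Fin n) (p n)
        {G : SimpleGraph (Fin n) | HasHamiltonCycleWithInversionsLE G (M n)})
      Filter.atTop (nhds 1) := by
  have hlog : ∀ᶠ n : ℕ in Filter.atTop, 1 ≤ Real.log n :=
    (Real.tendsto_log_atTop.comp tendsto_natCast_atTop_atTop).eventually_ge_atTop 1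
  have hbound : ∀ᶠ n : ℕ in Filter.atTop, 1 - 5 / (n : ℝ) ≤
      (SimpleGraph.binomialRandom (Fin n) (p n)).real
        {G : SimpleGraph (Fin n) | HasHamiltonCycleWithInversionsLE G (M n)} := by
    filter_upwards [hM, hp, hlog, Filter.eventually_ge_atTop 4] with n ⟨hM0, hM1⟩ hpn hlogn hn
    have hn0 : (4 : ℝ) ≤ n := by exact_mod_cast hn
    have hp0 : 0 < (p n : ℝ) := lt_of_lt_of_le (by positivity) hpn
    rw [div_le_iff₀ hM0] at hpn
    -- The `1` in `max K 1` is used here; the `K` gives `n p ≥ 100 log² n` through the upper bound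
    -- on `M`.
    have hMp : 100 * n / (p n : ℝ) ≤ M n := by
      rw [div_le_iff₀' hp0]
      have : 100 * 1 * (n : ℝ) ≤ 100 * max K 1 * n := by gcongr; exact le_max_right _ _
      linarith
    have hnp : 100 * Real.log n ^ 2 ≤ n * (p n : ℝ) := by
      rw [le_div_iff₀ (by positivity)] at hM1
      have h1 : 100 * K * (n : ℝ) ≤ 100 * max K 1 * n := by gcongr; exact le_max_left _ _
      have h2 : 100 * K * n * Real.log n ^ 2 ≤ p n * M n * Real.log n ^ 2 :=
        mul_le_mul_of_nonneg_right (h1.trans hpn) (by positivity)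
      have h3 : (p n : ℝ) * (M n * Real.log n ^ 2) ≤ p n * (K * n ^ 2) := by gcongr
      have h4 : (K * n) * (100 * Real.log n ^ 2) ≤ (K * n) * (n * (p n : ℝ)) := by linarith
      exact le_of_mul_le_mul_left h4 (by positivity)
    have hfail := binomialRandom_not_hasHamiltonCycle_le_div (p n) hp0 hn hlogn hnp
    have hcompl := MeasureTheory.probReal_compl_eq_one_sub
      (μ := SimpleGraph.binomialRandom (Fin n) (p n))
      (measurableSet_simpleGraph {G | HasHamiltonCycleWithInversionsLE G (100 * n / (p n : ℝ))})
    have hmono := binomialRandom_mono (p n) (V := Fin n) fun G h =>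
      HasHamiltonCycleWithInversionsLE.mono (G := G) h hMp
    have hcompl' : (SimpleGraph.binomialRandom (Fin n) (p n)).real
        {G | ¬ HasHamiltonCycleWithInversionsLE G (100 * n / (p n : ℝ))} =
        1 - (SimpleGraph.binomialRandom (Fin n) (p n)).real
          {G | HasHamiltonCycleWithInversionsLE G (100 * n / (p n : ℝ))} := hcompl
    linarith
  have hlim : Filter.Tendsto (fun n : ℕ => 1 - 5 / (n : ℝ)) Filter.atTop (nhds 1) := by
    simpa using (tendsto_const_div_atTop_nhds_zero_nat (5 : ℝ)).const_sub 1
  have hreal := tendsto_of_tendsto_of_tendsto_of_le_of_le' hlim tendsto_const_nhds hbound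
    (Filter.Eventually.of_forall fun n => MeasureTheory.measureReal_le_one)
  rw [← ENNReal.ofReal_one]
  refine (ENNReal.tendsto_ofReal hreal).congr fun n => ?_
  exact MeasureTheory.ofReal_measureReal
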